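/- Let $\mathcal X=[-\tfrac12,\tfrac12]$, $n\ge 1$ and $\boldsymbol\epsilon=(\epsilon_1,\dots,\epsilon_n)\in\mathbb R_{>0}^n$. A randomized algorithm $M$ assigns to every dataset $\mathbf x\in\mathcal X^n$ (measurably in $\mathbf x$) a probability distribution on $\mathbb R$; $M(\mathbf x)$ also denotes a sample from it. $M$ is $\boldsymbol\epsilon$-DP (heterogeneously differentially private) if for every $i$, all $\mathbf x,\mathbf x'\in\mathcal X^n$ that differ at most in the $i$-th entry, and every measurable $S\subseteq\mathbb R$, $$\Pr[M(\mathbf x)\in S]\le e^{\epsilon_i}\,\Pr[M(\mathbf x')\in S].$$ The worst-case mean-squared error of $M$ is $E(M)=\sup_P \mathbb E_{\mathbf X\sim P^n,\,M}\big[(M(\mathbf X)-\mu_P)^2\big]$, where $P$ ranges over all probability distributions on $\mathcal X$ and $\mu_P$ is the mean of $P$. The minimax risk is $L(\boldsymbol\epsilon)=\inf_M E(M)$ over all $\boldsymbol\epsilon$-DP randomized algorithms $M$ with outputs in $[-\tfrac12,\tfrac12]$. The algorithm ADPM is defined as follows. Index the users so that $\epsilon_1\le\dots\le\epsilon_n$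 (the entries of the dataset $\mathbf x$ being reordered accordingly). Put $r_1=\epsilon_1$ and, for $1\le k<n$, $$r_{k+1}=\min\Big\{\epsilon_{k+1},\ \frac{\sum_{j\le k}r_j^2+8}{\sum_{j\le k}r_j}\Big\}.$$ Let $L_1=\sum_{j=1}^n r_j$ and $L_2=\sum_{j=1}^n r_j^2$. If $\frac{L_2+8}{4L_1^2}>\frac14$, ADPM returns $0$. Otherwise it returns $\sum_{k=1}^n \frac{r_k}{L_1}\,x_k+N$, where $N$ is Laplace noise with scale $1/L_1$, i.e. with density $\frac{L_1}{2}e^{-L_1|t|}$. **Theorem.** There is a universal constant $C$ such that for every $n\ge1$ and every $\boldsymbol\epsilon\in\mathbb R_{>0}^n$, ADPM is an $\boldsymbol\epsilon$-DP randomized algorithm and $$L(\boldsymbol\epsilon)\ \le\ E(\mathrm{ADPM})\ \le\ C\,L(\boldsymbol\epsilon).$$ -/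

import Mathlib

open MeasureTheory ProbabilityTheory
open scoped ENNReal NNReal

namespace HeteroDP

noncomputable section

/-- Heterogeneous differential privacy of a randomized algorithm `M` (a Markov kernel from datasets
to outputs): user `i` has privacy level `ε i`, and `x`, `x'` are neighbouring datasets that differ
at most in the `i`-th entry. -/
def IsDP {X Y : Type*} [MeasurableSpace X] [MeasurableSpace Y] {n : ℕ}
    (M : Kernel (Fin n → X) Y) (ε : Fin n → ℝ) : Prop :=
  ∀ (i : Fin n) (x x' : Fin n → X), (∀ j, j ≠ i → x j = x' j) →
    ∀ S : Set Y, MeasurableSet S → M x S ≤ ENNReal.ofReal (Real.exp (ε i)) * M x' S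

/-- The data domain `[-1/2, 1/2]`. -/
abbrev DataPoint : Type := Set.Icc (-(1 / 2) : ℝ) (1 / 2)

/-- The mean of a distribution on the data domain. -/
def mean (P : Measure DataPoint) : ℝ := ∫ x, (x : ℝ) ∂P

/-- Mean-squared error of `M` as an estimator of the mean of `P`, when the dataset consists of `n`
independent samples from `P`; the expectation is over the dataset and over the algorithm. -/
def mse {n : ℕ} (M : Kernel (Fin n → DataPoint) ℝ) (P : Measure DataPoint) : ℝ≥0∞ :=
  ∫⁻ x, ∫⁻ y, ENNReal.ofReal ((y - mean P) ^ 2) ∂(M x) ∂(Measure.pi fun _ : Fin n => P)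

/-- Worst-case mean-squared error over all probability distributions on the data domain. -/
def worstCaseError {n : ℕ} (M : Kernel (Fin n → DataPoint) ℝ) : ℝ≥0∞ :=
  ⨆ (P : Measure DataPoint) (_ : IsProbabilityMeasure P), mse M P

/-- The `ε`-DP randomized algorithms from `[-1/2, 1/2]ⁿ` to `[-1/2, 1/2]`. -/
def dpAlgorithms {n : ℕ} (ε : Fin n → ℝ) : Set (Kernel (Fin n → DataPoint) ℝ) :=
  {M | IsMarkovKernel M ∧ IsDP M ε ∧ ∀ x, ∀ᵐ y ∂(M x), y ∈ Set.Icc (-(1 / 2) : ℝ) (1 / 2)}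

/-- The minimax risk. -/
def minimaxRisk {n : ℕ} (ε : Fin n → ℝ) : ℝ≥0∞ :=
  ⨅ M ∈ dpAlgorithms ε, worstCaseError M

/-- The Laplace distribution with scale `η > 0`. -/
def laplace (η : ℝ) : Measure ℝ :=
  volume.withDensity fun t => ENNReal.ofReal (1 / (2 * η) * Real.exp (-|t| / η))

/-- The `k`-th smallest privacy level, counted from `k = 0` (and `0` for `n ≤ k`, never used). -/
def sortedLevel {n : ℕ} (ε : Fin n → ℝ) (k : ℕ) : ℝ :=
  if h : k < n then ε (Tuple.sort ε ⟨k, h⟩) else 0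

/-- The variables of the loop of ADPM: the last computed entry of `r`, and the running sums `L₁` of
the entries of `r` and `L₂` of their squares. -/
structure LoopState where
  r : ℝ
  L₁ : ℝ
  L₂ : ℝ

/-- The loop of ADPM on the sorted privacy levels `e 0 ≤ e 1 ≤ …`: the state after `k` passes. -/
def loop (e : ℕ → ℝ) : ℕ → LoopState
  | 0 => ⟨e 0, e 0, e 0 ^ 2⟩
  | k + 1 =>
    let s := loop e k
    let r := min (e (k + 1)) ((s.L₂ + 8) / s.L₁)
    ⟨r, s.L₁ + r, s.L₂ + r ^ 2⟩

/-- Entry `k` (counted from `0`) of the vector `r` computed by ADPM. -/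
def adpmR {n : ℕ} (ε : Fin n → ℝ) (k : Fin n) : ℝ := (loop (sortedLevel ε) k).r

/-- The final value of `L₁`, the sum of all entries of `r`. -/
def adpmL₁ {n : ℕ} (ε : Fin n → ℝ) : ℝ := (loop (sortedLevel ε) (n - 1)).L₁

/-- The final value of `L₂`, the sum of the squares of all entries of `r`. -/
def adpmL₂ {n : ℕ} (ε : Fin n → ℝ) : ℝ := (loop (sortedLevel ε) (n - 1)).L₂

/-- The weighted sum `⟨w, x⟩` with `w = r / L₁`, where the user with the `k`-th smallest privacy
level receives the weight `w k`. -/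
def adpmCenter {n : ℕ} (ε : Fin n → ℝ) (x : Fin n → DataPoint) : ℝ :=
  ∑ k : Fin n, adpmR ε k / adpmL₁ ε * (x (Tuple.sort ε k) : ℝ)

theorem measurable_adpmCenter {n : ℕ} (ε : Fin n → ℝ) : Measurable (adpmCenter ε) := by
  unfold adpmCenter
  fun_prop

/-- The randomized algorithm that returns `c x + N` with noise `N` of law `ν`. -/
def addNoise {X : Type*} [MeasurableSpace X] (c : X → ℝ) (hc : Measurable c)
    (ν : Measure ℝ) [SFinite ν] : Kernel X ℝ where
  toFun x := ν.map fun N => c x + N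
  measurable' := by
    refine Measure.measurable_of_measurable_coe _ fun S hS => ?_
    have h : ∀ x, (ν.map fun N => c x + N) S =
        ν (Prod.mk x ⁻¹' ((fun p : X × ℝ => c p.1 + p.2) ⁻¹' S)) := fun x => by
      rw [Measure.map_apply (by fun_prop) hS]
      rfl
    simp_rw [h]
    exact measurable_measure_prodMk_left
      (((hc.comp measurable_fst).add measurable_snd) hS)

instance (η : ℝ) : SFinite (laplace η) := by
  unfold laplace
  infer_instance

open Classical in
/-- The algorithm ADPM: it returns `0` if `(L₂ + 8) / (4 L₁²) > 1/4`, and otherwise `⟨w, x⟩ + N`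
with `N` of Laplace distribution with scale `1 / L₁`. -/
def adpm {n : ℕ} (ε : Fin n → ℝ) : Kernel (Fin n → DataPoint) ℝ :=
  if (adpmL₂ ε + 8) / (4 * adpmL₁ ε ^ 2) > 1 / 4 then
    Kernel.const _ (Measure.dirac 0)
  else
    addNoise (adpmCenter ε) (measurable_adpmCenter ε) (laplace (1 / adpmL₁ ε))

end

end HeteroDP

/-! ### Water-filling and the balanced level. -/

namespace HeteroDP

/-! Both bounds are compared with the level `θ` solving `θ * ∑ min (ε i) θ = 1`; the risk turns out
to be of order `min (θ ^ 2) 1`.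

Upper bound: bias-variance and the Laplace variance bound the error by `(L₂ + 8) / (2 L₁²)`, or by
`1/2` when ADPM returns `0`. The loop caps the sorted levels at `R = (L₂ + 8) / L₁`
(`loop_r_eq_min`), which is the optimality condition for minimizing `(∑ s² + 8) / (∑ s)²` over `0 ≤
s ≤ ε` (`adpm_optimal`). Testing against `s = min ε θ` gives at most `9 θ²` (`adpm_rate_le`).

Lower bound: Le Cam's method with laws on the endpoints `±1/2` of bias `δ` and `-δ`, where `δ = min
(θ / 10) 1`. Privacy alone hides a change of law of the users with `ε i ≤ θ`
(`sum_bitWeight_private_le`); the others are too few to reveal it statistically, by a chi-square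
estimate (`sq_sum_bitWeight_nonprivate_le`). The equation for `θ` controls both contributions, so no
test separates the two laws and the risk is at least `δ² / 16` (`le_minimaxRisk`).

ADPM may leave `[-1/2, 1/2]`, so it is compared with the minimax risk through its clipped version
(`minimaxRisk_le`). -/

theorem loop_L₁_eq_sum (e : ℕ → ℝ) (k : ℕ) :
    (loop e k).L₁ = ∑ j ∈ Finset.range (k + 1), (loop e j).r := by
  induction k with
  | zero => simp [loop]
  | succ k ih =>
    rw [Finset.sum_range_succ, ← ih]
    rfl

theorem loop_L₂_eq_sum (e : ℕ → ℝ) (k : ℕ) :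
    (loop e k).L₂ = ∑ j ∈ Finset.range (k + 1), (loop e j).r ^ 2 := by
  induction k with
  | zero => simp [loop]
  | succ k ih =>
    rw [Finset.sum_range_succ, ← ih]
    rfl

theorem loop_pos (e : ℕ → ℝ) (k : ℕ) (he : ∀ j ≤ k, 0 < e j) :
    0 < (loop e k).r ∧ 0 < (loop e k).L₁ ∧ 0 < (loop e k).L₂ := by
  induction k with
  | zero =>
    have h := he 0 le_rfl
    exact ⟨h, h, pow_pos h 2⟩
  | succ k ih =>
    obtain ⟨h0, h1, h2⟩ := ih fun j hj => he j (by omega)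
    have hr : 0 < min (e (k + 1)) (((loop e k).L₂ + 8) / (loop e k).L₁) :=
      lt_min (he _ le_rfl) (by positivity)
    exact ⟨hr, add_pos h1 hr, add_pos h2 (pow_pos hr 2)⟩

/-- On nondecreasing privacy levels the loop computes a water-filling. -/
theorem loop_r_eq_min (e : ℕ → ℝ) (k : ℕ) (he : ∀ j ≤ k, 0 < e j)
    (hmono : ∀ i j, i ≤ j → j ≤ k → e i ≤ e j) :
    ∀ j ≤ k, (loop e j).r = min (e j) (((loop e k).L₂ + 8) / (loop e k).L₁) := by
  induction k with
  | zero =>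
    intro j hj
    obtain rfl : j = 0 := by omega
    have h := he 0 le_rfl
    symm
    apply min_eq_left
    simp only [loop]
    rw [le_div_iff₀ h]
    nlinarith
  | succ k ih =>
    have ih' := ih (fun j hj => he j (by omega)) (fun i j hij hj => hmono i j hij (by omega))
    obtain ⟨h0, h1, h2⟩ := loop_pos e k fun j hj => he j (by omega)
    set s := loop e k with hs
    set R := (s.L₂ + 8) / s.L₁ with hR
    have hRL : R * s.L₁ = s.L₂ + 8 := by rw [hR]; field_simp
    have hRpos : 0 < R := by positivity
    have hr : (loop e (k + 1)).r = min (e (k + 1)) R := rfl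
    have hq : ((loop e (k + 1)).L₂ + 8) / (loop e (k + 1)).L₁
        = (s.L₂ + min (e (k + 1)) R ^ 2 + 8) / (s.L₁ + min (e (k + 1)) R) := rfl
    -- If the new level is capped, adding `R` to `L₁` and `R²` to `L₂` leaves the quotient equal to
    -- `R`. Otherwise the new quotient is still at least `e (k + 1)`, hence above all levels so far,
    -- and nothing is capped.
    rcases le_or_gt R (e (k + 1)) with hle | hlt
    · have hq' : ((loop e (k + 1)).L₂ + 8) / (loop e (k + 1)).L₁ = R := by
        rw [hq, min_eq_right hle, div_eq_iff (by positivity)]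
        linear_combination -hRL
      rw [hq']
      intro j hj
      rcases Nat.lt_or_ge k j with hk | hk
      · obtain rfl : j = k + 1 := by omega
        exact hr
      · exact ih' j hk
    · have hek := he (k + 1) le_rfl
      have hq' : e (k + 1) ≤ ((loop e (k + 1)).L₂ + 8) / (loop e (k + 1)).L₁ := by
        rw [hq, min_eq_left hlt.le, le_div_iff₀ (by positivity)]
        nlinarith
      intro j hj
      have hej := hmono j (k + 1) hj le_rfl
      rw [min_eq_left (hej.trans hq')]
      rcases Nat.lt_or_ge k j with hk | hk
      · obtain rfl : j = k + 1 := by omega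
        rw [hr, min_eq_left hlt.le]
      · rw [ih' j hk, min_eq_left (hej.trans hlt.le)]

variable {n : ℕ} {ε : Fin n → ℝ}

theorem sortedLevel_coe (ε : Fin n → ℝ) (k : Fin n) :
    sortedLevel ε k = ε (Tuple.sort ε k) := by
  simp [sortedLevel]

theorem sortedLevel_pos (hε : ∀ i, 0 < ε i) {k : ℕ} (hk : k < n) : 0 < sortedLevel ε k := by
  simpa [sortedLevel, hk] using hε _

theorem sortedLevel_mono (ε : Fin n → ℝ) {i j : ℕ} (hij : i ≤ j) (hj : j < n) :
    sortedLevel ε i ≤ sortedLevel ε j := by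
  have h := Tuple.monotone_sort ε (show (⟨i, hij.trans_lt hj⟩ : Fin n) ≤ ⟨j, hj⟩ from hij)
  simpa [sortedLevel, hj, hij.trans_lt hj] using h

theorem adpmL₁_eq_sum (hn : 1 ≤ n) (ε : Fin n → ℝ) : adpmL₁ ε = ∑ k, adpmR ε k := by
  rw [adpmL₁, loop_L₁_eq_sum, Nat.sub_add_cancel hn]
  exact (Fin.sum_univ_eq_sum_range (fun j => (loop (sortedLevel ε) j).r) n).symm

theorem adpmL₂_eq_sum (hn : 1 ≤ n) (ε : Fin n → ℝ) : adpmL₂ ε = ∑ k, adpmR ε k ^ 2 := by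
  rw [adpmL₂, loop_L₂_eq_sum, Nat.sub_add_cancel hn]
  exact (Fin.sum_univ_eq_sum_range (fun j => (loop (sortedLevel ε) j).r ^ 2) n).symm

theorem adpmR_pos (hε : ∀ i, 0 < ε i) (k : Fin n) : 0 < adpmR ε k :=
  (loop_pos _ _ fun _ hj => sortedLevel_pos hε (hj.trans_lt k.2)).1

theorem adpmL₁_pos (hn : 1 ≤ n) (hε : ∀ i, 0 < ε i) : 0 < adpmL₁ ε :=
  (loop_pos _ _ fun _ _ => sortedLevel_pos hε (by omega)).2.1

theorem adpmL₂_pos (hn : 1 ≤ n) (hε : ∀ i, 0 < ε i) : 0 < adpmL₂ ε :=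
  (loop_pos _ _ fun _ _ => sortedLevel_pos hε (by omega)).2.2

theorem adpmR_eq_min (hε : ∀ i, 0 < ε i) (k : Fin n) :
    adpmR ε k = min (ε (Tuple.sort ε k)) ((adpmL₂ ε + 8) / adpmL₁ ε) := by
  rw [← sortedLevel_coe ε k]
  exact loop_r_eq_min _ _ (fun _ _ => sortedLevel_pos hε (by have := k.2; omega))
    (fun _ _ hij _ => sortedLevel_mono ε hij (by have := k.2; omega)) k (by have := k.2; omega)

theorem adpmR_le (hε : ∀ i, 0 < ε i) (k : Fin n) : adpmR ε k ≤ ε (Tuple.sort ε k) :=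
  (adpmR_eq_min hε k).trans_le (min_le_left _ _)

/-- The weights of ADPM minimize `(∑ s² + 8) / (∑ s)²` over the vectors `0 ≤ s ≤ ε`. -/
theorem adpm_optimal (hn : 1 ≤ n) (hε : ∀ i, 0 < ε i) (s : Fin n → ℝ) (hs0 : ∀ i, 0 ≤ s i)
    (hs : ∀ i, s i ≤ ε i) :
    (adpmL₂ ε + 8) / adpmL₁ ε ^ 2 * (∑ i, s i) ^ 2 ≤ ∑ i, s i ^ 2 + 8 := by
  have hL1 := adpmL₁_pos hn hε
  have hL2 := adpmL₂_pos hn hε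
  set R := (adpmL₂ ε + 8) / adpmL₁ ε with hR
  have hRL : R * adpmL₁ ε = adpmL₂ ε + 8 := by rw [hR]; field_simp
  have hRpos : 0 < R := by positivity
  set t : Fin n → ℝ := fun k => s (Tuple.sort ε k) with ht
  have hts : ∑ i, s i = ∑ k, t k := (Equiv.sum_comp (Tuple.sort ε) s).symm
  have hts2 : ∑ i, s i ^ 2 = ∑ k, t k ^ 2 :=
    (Equiv.sum_comp (Tuple.sort ε) fun i => s i ^ 2).symm
  -- Complementary slackness: `R - r k` vanishes at capped entries, and elsewhere `r k` equals the
  -- upper bound of `t k`.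
  have hslack : ∑ k, t k * (R - adpmR ε k) ≤ ∑ k, adpmR ε k * (R - adpmR ε k) := by
    refine Finset.sum_le_sum fun k _ => ?_
    have hk := adpmR_eq_min hε k
    rcases le_total (ε (Tuple.sort ε k)) R with h | h
    · rw [← hR, min_eq_left h] at hk
      rw [hk]
      exact mul_le_mul_of_nonneg_right (hs _) (by linarith)
    · rw [← hR, min_eq_right h] at hk
      simp [hk]
  have hsum8 : ∑ k, adpmR ε k * (R - adpmR ε k) = 8 := by
    simp_rw [mul_sub, Finset.sum_sub_distrib, ← Finset.sum_mul, ← sq]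
    rw [← adpmL₁_eq_sum hn, ← adpmL₂_eq_sum hn]
    linarith
  have hRT : R * ∑ k, t k ≤ ∑ k, t k * adpmR ε k + 8 := by
    simp_rw [mul_sub, Finset.sum_sub_distrib, ← Finset.sum_mul] at hslack hsum8
    linarith
  -- With the AM-GM bound below, this is Cauchy–Schwarz for `t` and `r`, each extended by a
  -- coordinate `√8`.
  have hCS := Finset.sum_mul_sq_le_sq_mul_sq Finset.univ t (adpmR ε)
  have hAM : 2 * ∑ k, t k * adpmR ε k ≤ ∑ k, t k ^ 2 + adpmL₂ ε := by
    rw [adpmL₂_eq_sum hn, Finset.mul_sum, ← Finset.sum_add_distrib]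
    exact Finset.sum_le_sum fun k _ => by nlinarith [sq_nonneg (t k - adpmR ε k)]
  rw [← adpmL₂_eq_sum hn] at hCS
  have hT : 0 ≤ ∑ k, t k := Finset.sum_nonneg fun k _ => hs0 _
  have hsq : (R * ∑ k, t k) ^ 2 ≤ (∑ k, t k * adpmR ε k + 8) ^ 2 :=
    pow_le_pow_left₀ (by positivity) hRT 2
  rw [hts, hts2]
  have hfin : (R * ∑ k, t k) ^ 2 ≤ (∑ k, t k ^ 2 + 8) * (adpmL₂ ε + 8) := by nlinarith
  have hu : (adpmL₂ ε + 8) / adpmL₁ ε ^ 2 * (adpmL₂ ε + 8) = R ^ 2 := by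
    rw [hR]; field_simp
  refine le_of_mul_le_mul_right ?_ (show 0 < adpmL₂ ε + 8 by positivity)
  calc _ = R ^ 2 * (∑ k, t k) ^ 2 := by rw [← hu]; ring
    _ ≤ _ := by rw [← mul_pow]; exact hfin

/-- The saturation level that balances the privacy budget. -/
theorem exists_balanced_level (hn : 1 ≤ n) (hε : ∀ i, 0 < ε i) :
    ∃ θ : ℝ, 0 < θ ∧ θ * ∑ i, min (ε i) θ = 1 := by
  set h : ℝ → ℝ := fun θ => θ * ∑ i, min (ε i) θ with hh
  have hc : Continuous h := by fun_prop
  set i₀ : Fin n := ⟨0, hn⟩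
  -- At this `b` the term of `i₀` alone is `ε i₀`, and the factor `b ≥ 1 / ε i₀` brings the product
  -- to at least `1`.
  set b := max (ε i₀) (1 / ε i₀) with hb
  have hbpos : 0 < b := lt_max_of_lt_left (hε i₀)
  have hge : 1 ≤ h b := by
    have h1 : ε i₀ ≤ ∑ i, min (ε i) b := by
      calc ε i₀ = min (ε i₀) b := (min_eq_left (le_max_left _ _)).symm
        _ ≤ _ := Finset.single_le_sum (f := fun i => min (ε i) b)
          (fun i _ => (lt_min (hε i) hbpos).le) (Finset.mem_univ i₀)
    calc (1 : ℝ) = 1 / ε i₀ * ε i₀ := by have := (hε i₀).ne'; field_simp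
      _ ≤ _ := mul_le_mul (le_max_right _ _) h1 (hε i₀).le hbpos.le
  obtain ⟨θ, hθ, hθ1⟩ := intermediate_value_Icc hbpos.le hc.continuousOn
    (show (1 : ℝ) ∈ Set.Icc (h 0) (h b) from ⟨by simp [hh], hge⟩)
  refine ⟨θ, lt_of_le_of_ne hθ.1 ?_, hθ1⟩
  rintro rfl
  simp [hh] at hθ1

/-- The competitor `s = min ε θ` has `∑ s = 1 / θ` and `∑ s² ≤ θ ∑ s = 1`, whence `9 = 1 + 8`. -/
theorem adpm_rate_le (hn : 1 ≤ n) (hε : ∀ i, 0 < ε i) {θ : ℝ} (hθ : 0 < θ)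
    (h : θ * ∑ i, min (ε i) θ = 1) : (adpmL₂ ε + 8) / adpmL₁ ε ^ 2 ≤ 9 * θ ^ 2 := by
  have hopt := adpm_optimal hn hε (fun i => min (ε i) θ) (fun i => (lt_min (hε i) hθ).le)
    (fun i => min_le_left _ _)
  have hsq : ∑ i, min (ε i) θ ^ 2 ≤ 1 := by
    rw [← h, Finset.mul_sum]
    exact Finset.sum_le_sum fun i _ => by
      rw [sq]
      exact mul_le_mul_of_nonneg_right (min_le_right _ _) (lt_min (hε i) hθ).le
  have hmul := mul_le_mul_of_nonneg_left (hopt.trans (add_le_add_left hsq 8)) (sq_nonneg θ)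
  calc _ = (adpmL₂ ε + 8) / adpmL₁ ε ^ 2 * (θ * ∑ i, min (ε i) θ) ^ 2 := by rw [h]; ring
    _ = θ ^ 2 * ((adpmL₂ ε + 8) / adpmL₁ ε ^ 2 * (∑ i, min (ε i) θ) ^ 2) := by ring
    _ ≤ _ := hmul.trans_eq (by ring)

end HeteroDP

namespace HeteroDP

/-! ### Laplace noise: moments and privacy. -/

section Laplace

theorem integral_abs_pow_mul_laplace_density {η : ℝ} (hη : 0 < η) (k : ℕ) :
    ∫ t : ℝ, |t| ^ k * (1 / (2 * η) * Real.exp (-|t| / η)) = η ^ k * k.factorial := by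
  rw [integral_comp_abs (f := fun t => t ^ k * (1 / (2 * η) * Real.exp (-t / η)))]
  have h := Real.integral_rpow_mul_exp_neg_mul_Ioi (a := k + 1) (r := 1 / η) (by positivity)
    (by positivity)
  have h2 : ∫ t in Set.Ioi (0 : ℝ), t ^ k * (1 / (2 * η) * Real.exp (-t / η))
      = 1 / (2 * η) * ∫ t in Set.Ioi (0 : ℝ), t ^ ((k : ℝ) + 1 - 1) * Real.exp (-(1 / η * t)) := by
    rw [← integral_const_mul]
    refine setIntegral_congr_fun measurableSet_Ioi fun t _ => ?_
    simp only [add_sub_cancel_right, Real.rpow_natCast]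
    rw [show -t / η = -(1 / η * t) by ring]
    ring
  rw [h2, h, Real.Gamma_nat_eq_factorial, one_div_one_div]
  have : η ^ ((k : ℝ) + 1) = η ^ k * η := by exact_mod_cast (pow_succ η k)
  rw [this]
  field_simp

theorem lintegral_abs_pow_laplace {η : ℝ} (hη : 0 < η) (k : ℕ) :
    ∫⁻ t, ENNReal.ofReal (|t| ^ k) ∂(laplace η) = ENNReal.ofReal (η ^ k * k.factorial) := by
  have hval := integral_abs_pow_mul_laplace_density hη k
  have hint : Integrable fun t : ℝ => |t| ^ k * (1 / (2 * η) * Real.exp (-|t| / η)) := by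
    -- A non-integrable function has integral `0` by convention, but the computed value is positive.
    by_contra h
    rw [integral_undef h] at hval
    have : 0 < η ^ k * k.factorial := by positivity
    linarith
  rw [laplace, lintegral_withDensity_eq_lintegral_mul _ (by fun_prop) (by fun_prop), ← hval,
    ofReal_integral_eq_lintegral_ofReal hint (ae_of_all _ fun t => by positivity)]
  refine lintegral_congr fun t => ?_
  rw [Pi.mul_apply, mul_comm, ← ENNReal.ofReal_mul (by positivity)]

theorem isProbabilityMeasure_laplace {η : ℝ} (hη : 0 < η) : IsProbabilityMeasure (laplace η) := by
  refine ⟨?_⟩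
  have h := lintegral_abs_pow_laplace hη 0
  simpa using h

end Laplace

section AddNoise

variable {X : Type*} [MeasurableSpace X]

theorem addNoise_apply (c : X → ℝ) (hc : Measurable c) (ν : Measure ℝ) [SFinite ν] (x : X) :
    addNoise c hc ν x = ν.map fun N => c x + N := rfl

theorem isMarkovKernel_addNoise (c : X → ℝ) (hc : Measurable c) (ν : Measure ℝ)
    [IsProbabilityMeasure ν] : IsMarkovKernel (addNoise c hc ν) :=
  ⟨fun x => by
    rw [addNoise_apply]
    exact Measure.isProbabilityMeasure_map (by fun_prop)⟩

theorem map_const_add_laplace_apply (η a : ℝ) {S : Set ℝ} (hS : MeasurableSet S) :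
    (laplace η).map (fun N => a + N) S
      = ∫⁻ y in S, ENNReal.ofReal (1 / (2 * η) * Real.exp (-|y - a| / η)) := by
  have hpre : MeasurableSet ((fun N => a + N) ⁻¹' S) := measurable_const_add a hS
  rw [Measure.map_apply (by fun_prop) hS, laplace, withDensity_apply _ hpre,
    ← lintegral_indicator hpre, ← lintegral_indicator hS]
  rw [← lintegral_add_left_eq_self (μ := volume) (S.indicator _) a]
  refine lintegral_congr fun t => ?_
  simp only [Set.indicator, add_sub_cancel_left]
  rfl

theorem map_const_add_laplace_le {η : ℝ} (hη : 0 < η) {a a' b : ℝ} (h : |a - a'| ≤ b * η)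
    {S : Set ℝ} (hS : MeasurableSet S) :
    (laplace η).map (fun N => a + N) S
      ≤ ENNReal.ofReal (Real.exp b) * (laplace η).map (fun N => a' + N) S := by
  rw [map_const_add_laplace_apply η a hS, map_const_add_laplace_apply η a' hS,
    ← lintegral_const_mul _ (by fun_prop)]
  refine lintegral_mono fun y => ?_
  rw [← ENNReal.ofReal_mul (Real.exp_pos _).le]
  refine ENNReal.ofReal_le_ofReal ?_
  have hexp : -|y - a| / η ≤ b + -|y - a'| / η := by
    rw [div_le_iff₀ hη, add_mul, div_mul_cancel₀ _ hη.ne']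
    have := abs_sub_le y a a'
    linarith
  calc 1 / (2 * η) * Real.exp (-|y - a| / η)
      ≤ 1 / (2 * η) * Real.exp (b + -|y - a'| / η) := by gcongr
    _ = _ := by rw [Real.exp_add]; ring

end AddNoise

/-! ### Clipping to the output range. -/

section Clip

/-- Projection of the real line onto `[-1/2, 1/2]`. -/
noncomputable def clip (y : ℝ) : ℝ := max (-(1 / 2)) (min y (1 / 2))

theorem measurable_clip : Measurable clip := by
  unfold clip
  fun_prop

theorem clip_mem (y : ℝ) : clip y ∈ Set.Icc (-(1 / 2) : ℝ) (1 / 2) :=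
  ⟨le_max_left _ _, max_le (by norm_num) (min_le_right _ _)⟩

theorem sq_clip_sub_le (y : ℝ) {m : ℝ} (hm : m ∈ Set.Icc (-(1 / 2) : ℝ) (1 / 2)) :
    (clip y - m) ^ 2 ≤ (y - m) ^ 2 := by
  obtain ⟨h1, h2⟩ := hm
  rw [sq_le_sq]
  unfold clip
  rcases le_total y (1 / 2) with h | h
  · rw [min_eq_left h]
    rcases le_total (-(1 / 2)) y with h' | h'
    · rw [max_eq_right h']
    · rw [max_eq_left h', abs_of_nonpos (by linarith), abs_of_nonpos (by linarith)]
      linarith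
  · rw [min_eq_right h, max_eq_right (by norm_num), abs_of_nonneg (by linarith),
      abs_of_nonneg (by linarith)]
    linarith

theorem mean_mem (P : Measure DataPoint) [IsProbabilityMeasure P] :
    mean P ∈ Set.Icc (-(1 / 2) : ℝ) (1 / 2) := by
  have hint : Integrable (fun x : DataPoint => (x : ℝ)) P :=
    Integrable.of_mem_Icc (-(1 / 2)) (1 / 2) (by fun_prop) (ae_of_all _ fun x => x.2)
  constructor
  · calc -(1 / 2) = ∫ _ : DataPoint, (-(1 / 2) : ℝ) ∂P := by simp
      _ ≤ _ := integral_mono (integrable_const _) hint fun x => x.2.1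
  · calc mean P ≤ ∫ _ : DataPoint, (1 / 2 : ℝ) ∂P :=
          integral_mono hint (integrable_const _) fun x => x.2.2
      _ = 1 / 2 := by simp

variable {n : ℕ} {ε : Fin n → ℝ}

theorem IsDP.map {X Y Z : Type*} [MeasurableSpace X] [MeasurableSpace Y] [MeasurableSpace Z]
    {M : Kernel (Fin n → X) Y} (hM : IsDP M ε) {f : Y → Z} (hf : Measurable f) :
    IsDP (M.map f) ε := by
  intro i x x' hx S hS
  rw [Kernel.map_apply' _ hf _ hS, Kernel.map_apply' _ hf _ hS]
  exact hM i x x' hx _ (hf hS)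

theorem clip_mem_dpAlgorithms {M : Kernel (Fin n → DataPoint) ℝ} [IsMarkovKernel M]
    (hM : IsDP M ε) : M.map clip ∈ dpAlgorithms ε := by
  refine ⟨Kernel.IsMarkovKernel.map M measurable_clip, hM.map measurable_clip, fun x => ?_⟩
  rw [Kernel.map_apply _ measurable_clip]
  exact (ae_map_iff (p := fun y => y ∈ Set.Icc (-(1 / 2) : ℝ) (1 / 2))
    measurable_clip.aemeasurable measurableSet_Icc).2 (ae_of_all _ clip_mem)

theorem worstCaseError_clip_le (M : Kernel (Fin n → DataPoint) ℝ) :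
    worstCaseError (M.map clip) ≤ worstCaseError M := by
  refine iSup₂_mono fun P hP => lintegral_mono fun x => ?_
  rw [Kernel.map_apply _ measurable_clip, lintegral_map (by fun_prop) measurable_clip]
  exact lintegral_mono fun y => ENNReal.ofReal_le_ofReal (sq_clip_sub_le y (mean_mem P))

/-- Clipping is post-processing, so it preserves privacy; as the mean lies in `[-1/2, 1/2]`, it does
not increase the error. -/
theorem minimaxRisk_le {M : Kernel (Fin n → DataPoint) ℝ} [IsMarkovKernel M] (hM : IsDP M ε) :
    minimaxRisk ε ≤ worstCaseError M :=
  (iInf₂_le _ (clip_mem_dpAlgorithms hM)).trans (worstCaseError_clip_le M)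

end Clip

/-! ### Privacy of ADPM. -/

section Privacy

variable {n : ℕ} {ε : Fin n → ℝ}

theorem isMarkovKernel_adpm (hn : 1 ≤ n) (hε : ∀ i, 0 < ε i) : IsMarkovKernel (adpm ε) := by
  unfold adpm
  split_ifs
  · infer_instance
  · have := isProbabilityMeasure_laplace (one_div_pos.2 (adpmL₁_pos hn hε))
    exact isMarkovKernel_addNoise _ _ _

/-- The data interval has length `1`, so a user moves the center by at most their weight `r / L₁`,
and `r` never exceeds their level. -/
theorem abs_adpmCenter_sub_le (hn : 1 ≤ n) (hε : ∀ i, 0 < ε i) (i : Fin n)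
    (x x' : Fin n → DataPoint) (hx : ∀ j, j ≠ i → x j = x' j) :
    |adpmCenter ε x - adpmCenter ε x'| ≤ ε i * (1 / adpmL₁ ε) := by
  obtain ⟨k, rfl⟩ := (Tuple.sort ε).surjective i
  have hL1 := adpmL₁_pos hn hε
  have hdiff : adpmCenter ε x - adpmCenter ε x' = adpmR ε k / adpmL₁ ε *
      ((x (Tuple.sort ε k) : ℝ) - x' (Tuple.sort ε k)) := by
    rw [adpmCenter, adpmCenter, ← Finset.sum_sub_distrib, Finset.sum_eq_single k]
    · ring
    · intro j _ hj
      rw [hx _ fun h => hj ((Tuple.sort ε).injective h), sub_self]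
    · simp
  have hx1 : |(x (Tuple.sort ε k) : ℝ) - x' (Tuple.sort ε k)| ≤ 1 := by
    have h1 := (x (Tuple.sort ε k)).2
    have h2 := (x' (Tuple.sort ε k)).2
    rw [abs_le]
    constructor <;> linarith [h1.1, h1.2, h2.1, h2.2]
  have hr := adpmR_pos hε k
  rw [hdiff, abs_mul, abs_of_pos (by positivity)]
  calc _ ≤ adpmR ε k / adpmL₁ ε * 1 := by gcongr
    _ = adpmR ε k * (1 / adpmL₁ ε) := by ring
    _ ≤ _ := by
      gcongr
      exact adpmR_le hε k

theorem isDP_adpm (hn : 1 ≤ n) (hε : ∀ i, 0 < ε i) : IsDP (adpm ε) ε := by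
  intro i x x' hx S hS
  unfold adpm
  split_ifs
  · rw [Kernel.const_apply, Kernel.const_apply]
    refine le_mul_of_one_le_left zero_le ?_
    rw [ENNReal.one_le_ofReal, Real.one_le_exp_iff]
    exact (hε i).le
  · rw [addNoise_apply, addNoise_apply]
    exact map_const_add_laplace_le (one_div_pos.2 (adpmL₁_pos hn hε))
      (abs_adpmCenter_sub_le hn hε i x x' hx) hS

end Privacy

/-! ### Upper bound on the error of ADPM. -/

section Error

variable {n : ℕ} {ε : Fin n → ℝ}

theorem lintegral_sq_addNoise_laplace_le {η : ℝ} (hη : 0 < η) (a m : ℝ) :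
    ∫⁻ y, ENNReal.ofReal ((y - m) ^ 2) ∂((laplace η).map fun N => a + N)
      ≤ ENNReal.ofReal (2 * (a - m) ^ 2) + ENNReal.ofReal (4 * η ^ 2) := by
  have := isProbabilityMeasure_laplace hη
  rw [lintegral_map (by fun_prop) (by fun_prop)]
  calc _ ≤ ∫⁻ N, (ENNReal.ofReal (2 * (a - m) ^ 2) +
          ENNReal.ofReal 2 * ENNReal.ofReal (|N| ^ 2)) ∂(laplace η) := by
        refine lintegral_mono fun N => ?_
        rw [← ENNReal.ofReal_mul (by norm_num), ← ENNReal.ofReal_add (by positivity) (by positivity),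
          sq_abs]
        exact ENNReal.ofReal_le_ofReal (by nlinarith [sq_nonneg (a - m - N)])
    _ = _ := by
        rw [lintegral_add_left (by fun_prop), lintegral_const_mul _ (by fun_prop),
          lintegral_abs_pow_laplace hη, ← ENNReal.ofReal_mul (by norm_num)]
        simp only [lintegral_const, measure_univ, mul_one]
        congr 2
        norm_num [Nat.factorial]
        ring

theorem lintegral_sq_adpmCenter_sub_mean_le (hn : 1 ≤ n) (hε : ∀ i, 0 < ε i)
    (P : Measure DataPoint) [IsProbabilityMeasure P] :
    ∫⁻ x, ENNReal.ofReal ((adpmCenter ε x - mean P) ^ 2) ∂(Measure.pi fun _ : Fin n => P)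
      ≤ ENNReal.ofReal (adpmL₂ ε / (4 * adpmL₁ ε ^ 2)) := by
  have hL1 := adpmL₁_pos hn hε
  -- The weights are re-indexed by user instead of by rank.
  set w : Fin n → ℝ := fun i => adpmR ε ((Tuple.sort ε).symm i) / adpmL₁ ε with hw
  set Y : Fin n → DataPoint → ℝ := fun i x => w i * (x : ℝ) with hY
  have hc : adpmCenter ε = ∑ i, fun x : Fin n → DataPoint => Y i (x i) := by
    ext x
    rw [Finset.sum_apply, adpmCenter, ← Equiv.sum_comp (Tuple.sort ε) fun i => Y i (x i)]
    simp [hY, hw]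
  have hbd : ∀ᵐ x : DataPoint ∂P, (x : ℝ) ∈ Set.Icc (-(1 / 2) : ℝ) (1 / 2) :=
    ae_of_all _ fun x => x.2
  have hid : MemLp (fun x : DataPoint => (x : ℝ)) 2 P :=
    memLp_of_bounded hbd (by fun_prop) 2
  have hmem : ∀ i, MemLp (Y i) 2 P := fun i => hid.const_mul (w i)
  have hmemc : MemLp (adpmCenter ε) 2 (Measure.pi fun _ : Fin n => P) := by
    rw [hc]
    exact memLp_finsetSum' _ fun i _ =>
      (hmem i).comp_measurePreserving (measurePreserving_eval (fun _ : Fin n => P) i)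
  have hw1 : ∑ i, w i = 1 := by
    rw [← Equiv.sum_comp (Tuple.sort ε)]
    simp only [hw, Equiv.symm_apply_apply]
    rw [← Finset.sum_div, ← adpmL₁_eq_sum hn, div_self hL1.ne']
  have hw2 : ∑ i, w i ^ 2 = adpmL₂ ε / adpmL₁ ε ^ 2 := by
    rw [← Equiv.sum_comp (Tuple.sort ε)]
    simp only [hw, Equiv.symm_apply_apply, div_pow]
    rw [← Finset.sum_div, ← adpmL₂_eq_sum hn]
  have hmean : ∫ x, adpmCenter ε x ∂(Measure.pi fun _ : Fin n => P) = mean P := by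
    rw [hc]
    simp only [Finset.sum_apply]
    rw [integral_finsetSum _ fun i _ => ?_]
    · have : ∀ i, ∫ x : Fin n → DataPoint, Y i (x i) ∂(Measure.pi fun _ : Fin n => P)
          = w i * mean P := fun i => by
        rw [integral_comp_eval (μ := fun _ : Fin n => P) (hmem i).aestronglyMeasurable,
          mean, ← integral_const_mul]
      simp_rw [this]
      rw [← Finset.sum_mul, hw1, one_mul]
    · exact integrable_comp_eval (μ := fun _ : Fin n => P) ((hmem i).integrable (by norm_num))
  have hvar : Var[adpmCenter ε; Measure.pi fun _ : Fin n => P]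
      ≤ adpmL₂ ε / (4 * adpmL₁ ε ^ 2) := by
    rw [hc, variance_sum_pi hmem]
    calc ∑ i, Var[Y i; P] ≤ ∑ i, w i ^ 2 * (1 / 4) := by
          refine Finset.sum_le_sum fun i _ => ?_
          rw [hY, variance_const_mul]
          refine mul_le_mul_of_nonneg_left ?_ (sq_nonneg _)
          -- Popoviciu: a variable in an interval of length `1` has variance at most `1/4`.
          refine (variance_le_sq_of_bounded hbd (by fun_prop)).trans ?_
          norm_num
      _ = _ := by
        rw [← Finset.sum_mul, hw2]
        field_simp
  rw [variance_eq_integral hmemc.aestronglyMeasurable.aemeasurable, hmean] at hvar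
  rw [← ofReal_integral_eq_lintegral_ofReal]
  · exact ENNReal.ofReal_le_ofReal hvar
  · exact (hmemc.sub (memLp_const _)).integrable_sq
  · exact ae_of_all _ fun x => sq_nonneg _

theorem worstCaseError_adpm_le (hn : 1 ≤ n) (hε : ∀ i, 0 < ε i) :
    worstCaseError (adpm ε)
      ≤ ENNReal.ofReal (min (1 / 2) ((adpmL₂ ε + 8) / (2 * adpmL₁ ε ^ 2))) := by
  have hL1 := adpmL₁_pos hn hε
  have hL2 := adpmL₂_pos hn hε
  have hu : (adpmL₂ ε + 8) / (2 * adpmL₁ ε ^ 2)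
      = 2 * ((adpmL₂ ε + 8) / (4 * adpmL₁ ε ^ 2)) := by field_simp; norm_num
  refine iSup₂_le fun P hP => ?_
  unfold mse adpm
  split_ifs with h
  · rw [min_eq_left (by rw [hu]; linarith)]
    simp only [Kernel.const_apply, lintegral_const, measure_univ, mul_one]
    rw [lintegral_dirac' _ (by fun_prop)]
    refine ENNReal.ofReal_le_ofReal ?_
    obtain ⟨h1, h2⟩ := mean_mem P
    nlinarith
  · rw [min_eq_right (by rw [hu]; linarith)]
    have hη := one_div_pos.2 hL1
    -- The origin of the `8`: `2 * L₂ / (4 L₁²) + 4 / L₁² = (L₂ + 8) / (2 L₁²)`.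
    calc _ ≤ ∫⁻ x, (ENNReal.ofReal 2 * ENNReal.ofReal ((adpmCenter ε x - mean P) ^ 2) +
            ENNReal.ofReal (4 * (1 / adpmL₁ ε) ^ 2)) ∂(Measure.pi fun _ : Fin n => P) := by
          refine lintegral_mono fun x => ?_
          rw [← ENNReal.ofReal_mul (by norm_num), addNoise_apply]
          exact lintegral_sq_addNoise_laplace_le hη _ _
      _ ≤ ENNReal.ofReal 2 * ENNReal.ofReal (adpmL₂ ε / (4 * adpmL₁ ε ^ 2)) +
            ENNReal.ofReal (4 * (1 / adpmL₁ ε) ^ 2) := by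
          have := measurable_adpmCenter ε
          rw [lintegral_add_right _ (by fun_prop), lintegral_const_mul _ (by fun_prop)]
          simp only [lintegral_const, measure_univ, mul_one]
          gcongr
          exact lintegral_sq_adpmCenter_sub_mean_le hn hε P
      _ = _ := by
          rw [← ENNReal.ofReal_mul (by norm_num), ← ENNReal.ofReal_add (by positivity)
            (by positivity)]
          congr 1
          field_simp
          ring

end Error

end HeteroDP

namespace HeteroDP

/-! ### Indistinguishability of product laws on the hypercube. -/

section Hypercube

variable {ι : Type*} [Fintype ι]

/-- The sign `±1` of a bit. -/
def sgn (b : Bool) : ℝ := if b then 1 else -1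

@[simp] theorem sgn_true : sgn true = 1 := rfl

@[simp] theorem sgn_false : sgn false = -1 := rfl

@[simp] theorem sgn_not (b : Bool) : sgn (!b) = -sgn b := by cases b <;> simp

/-- The probability of the bit vector `b` when the bits are independent with means `a i` (as
signs). -/
noncomputable def bitWeight (a : ι → ℝ) (b : ι → Bool) : ℝ := ∏ i, (1 + a i * sgn (b i)) / 2

theorem bit_factor_nonneg {a : ℝ} (ha : |a| ≤ 1) (b : Bool) : 0 ≤ (1 + a * sgn b) / 2 := by
  obtain ⟨h1, h2⟩ := abs_le.1 ha
  cases b <;> simp <;> linarith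

theorem bitWeight_nonneg {a : ι → ℝ} (ha : ∀ i, |a i| ≤ 1) (b : ι → Bool) : 0 ≤ bitWeight a b :=
  Finset.prod_nonneg fun i _ => bit_factor_nonneg (ha i) (b i)

variable [DecidableEq ι]

theorem sum_prod_bool {R : Type*} [CommSemiring R] (φ : ι → Bool → R) :
    ∑ b : ι → Bool, ∏ i, φ i (b i) = ∏ i, (φ i true + φ i false) := by
  have h := Finset.prod_univ_sum (fun _ : ι => (Finset.univ : Finset Bool)) φ
  rw [Fintype.piFinset_univ] at h
  rw [← h]
  simp

theorem sum_bitWeight (a : ι → ℝ) : ∑ b, bitWeight a b = 1 := by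
  unfold bitWeight
  rw [sum_prod_bool fun i b => (1 + a i * sgn b) / 2]
  exact Finset.prod_eq_one fun i _ => by simp; ring

/-- Changing the law of a single bit changes the expectation of a function in proportion to its
sensitivity to that bit. -/
theorem sum_bitWeight_update_sub_le {a : ι → ℝ} (ha : ∀ i, |a i| ≤ 1) (i : ι) {c : ℝ}
    (hc : c ≤ a i) (F : (ι → Bool) → ℝ) {K : ℝ}
    (hF : ∀ b b' : ι → Bool, (∀ j, j ≠ i → b j = b' j) → F b - F b' ≤ K) :
    ∑ b, (bitWeight a b - bitWeight (Function.update a i c) b) * F b ≤ (a i - c) / 2 * K := by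
  -- The weight of the bits other than `i`; its total is `2` because bit `i` remains free. Pairing
  -- each `b` with its flip at `i` then exposes differences of `F`.
  set G : (ι → Bool) → ℝ := fun b => ∏ j, if j = i then 1 else (1 + a j * sgn (b j)) / 2 with hG
  have hG0 : ∀ b, 0 ≤ G b := fun b => Finset.prod_nonneg fun j _ => by
    split_ifs
    · exact zero_le_one
    · exact bit_factor_nonneg (ha j) (b j)
  have hGsum : ∑ b, G b = 2 := by
    rw [hG, sum_prod_bool fun j b => if j = i then (1 : ℝ) else (1 + a j * sgn b) / 2,
      Finset.prod_eq_single i]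
    · norm_num
    · intro j _ hj
      simp [hj]
      ring
    · simp
  have hW : ∀ (d : ι → ℝ), (∀ j, j ≠ i → d j = a j) → ∀ b,
      bitWeight d b = (1 + d i * sgn (b i)) / 2 * G b := by
    intro d hd b
    rw [bitWeight, hG, ← Finset.mul_prod_erase _ _ (Finset.mem_univ i)]
    simp only
    rw [← Finset.mul_prod_erase _ _ (Finset.mem_univ i), if_pos rfl, one_mul]
    congr 1
    refine Finset.prod_congr rfl fun j hj => ?_
    have hji := Finset.ne_of_mem_erase hj
    rw [if_neg hji, hd j hji]
  set f : (ι → Bool) → (ι → Bool) := fun b => Function.update b i (!b i) with hf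
  have hinv : Function.Involutive f := fun b => by simp [hf]
  have hGf : ∀ b, G (f b) = G b := fun b => Finset.prod_congr rfl fun j _ => by
    by_cases h : j = i <;> simp [h, hf]
  have hpair : ∑ b, sgn (b i) * G b * F b = ∑ b, G b / 2 * (sgn (b i) * (F b - F (f b))) := by
    have h := Equiv.sum_comp (hinv.toPerm f) fun b => sgn (b i) * G b * F b
    simp only [Function.Involutive.coe_toPerm, hGf] at h
    have h2 : ∀ b, sgn (f b i) = -sgn (b i) := fun b => by simp [hf]
    simp only [h2] at h
    have h3 : ∑ b, G b / 2 * (sgn (b i) * (F b - F (f b)))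
        = (∑ b, sgn (b i) * G b * F b + ∑ b, -sgn (b i) * G b * F (f b)) / 2 := by
      rw [← Finset.sum_add_distrib, Finset.sum_div]
      exact Finset.sum_congr rfl fun b _ => by ring
    rw [h3, h]
    ring
  have hbound : ∑ b, sgn (b i) * G b * F b ≤ K := by
    rw [hpair]
    calc _ ≤ ∑ b, G b / 2 * K := by
          refine Finset.sum_le_sum fun b _ => mul_le_mul_of_nonneg_left ?_ (by linarith [hG0 b])
          have hfb : ∀ j, j ≠ i → f b j = b j := fun j hj => by simp [hf, hj]
          have h1 := hF b (f b) fun j hj => (hfb j hj).symm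
          have h2 := hF (f b) b hfb
          cases b i <;> simp <;> linarith
      _ = K := by rw [← Finset.sum_mul, ← Finset.sum_div, hGsum]; ring
  calc _ = (a i - c) / 2 * ∑ b, sgn (b i) * G b * F b := by
        rw [Finset.mul_sum]
        refine Finset.sum_congr rfl fun b _ => ?_
        rw [hW a (fun _ _ => rfl), hW (Function.update a i c) fun j hj => by simp [hj]]
        simp only [Function.update_self]
        ring
    _ ≤ _ := mul_le_mul_of_nonneg_left hbound (by linarith)

/-- Signed biases `-δ` on `B` and `δ` outside of `B`. -/
noncomputable def signedBias (δ : ℝ) (B : Finset ι) (i : ι) : ℝ := if i ∈ B then -δ else δ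

theorem abs_signedBias_le {κ : Type*} [DecidableEq κ] {δ : ℝ} (hδ0 : 0 ≤ δ) (hδ1 : δ ≤ 1)
    (B : Finset κ) (i : κ) :
    |signedBias δ B i| ≤ 1 := by
  unfold signedBias
  split_ifs <;> simp [abs_of_nonneg hδ0, hδ1]

/-- Hybrid argument: the biases on `A` are flipped from `δ` to `-δ` one at a time, each flip costing
at most `δ * K i`. -/
theorem sum_bitWeight_private_le {δ : ℝ} (hδ0 : 0 ≤ δ) (hδ1 : δ ≤ 1) (F : (ι → Bool) → ℝ)
    {K : ι → ℝ} (A : Finset ι)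
    (hF : ∀ i ∈ A, ∀ b b' : ι → Bool, (∀ j, j ≠ i → b j = b' j) → F b - F b' ≤ K i) :
    ∑ b, (bitWeight (fun _ => δ) b - bitWeight (signedBias δ A) b) * F b
      ≤ δ * ∑ i ∈ A, K i := by
  induction A using Finset.induction_on with
  | empty =>
    have h : signedBias δ ∅ = fun _ : ι => δ := by ext; simp [signedBias]
    simp [h]
  | insert i B hi ih =>
    have ih := ih fun j hj => hF j (Finset.mem_insert_of_mem hj)
    have hup : signedBias δ (insert i B) = Function.update (signedBias δ B) i (-δ) := by
      ext j
      by_cases h : j = i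
      · subst h; simp [signedBias]
      · simp [signedBias, h]
    have hsi : signedBias δ B i = δ := by simp [signedBias, hi]
    have h := sum_bitWeight_update_sub_le (abs_signedBias_le hδ0 hδ1 B) i (c := -δ)
      (by rw [hsi]; linarith) F (hF i (Finset.mem_insert_self i B))
    rw [← hup, hsi] at h
    rw [Finset.sum_insert hi]
    calc _ = ∑ b, (bitWeight (fun _ => δ) b - bitWeight (signedBias δ B) b) * F b +
          ∑ b, (bitWeight (signedBias δ B) b - bitWeight (signedBias δ (insert i B)) b) * F b := by
          rw [← Finset.sum_add_distrib]
          exact Finset.sum_congr rfl fun b _ => by ring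
      _ ≤ _ := add_le_add ih h
      _ = _ := by ring

/-- Second-moment bound: Cauchy–Schwarz against a reference law bounds the gap by the mean square of
the difference of two likelihood ratios. -/
theorem sq_sum_bitWeight_nonprivate_le {δ : ℝ} (hδ0 : 0 ≤ δ) (hδ1 : δ ≤ 1)
    (F : (ι → Bool) → ℝ) (hF0 : ∀ b, 0 ≤ F b) (hF1 : ∀ b, F b ≤ 1) (A : Finset ι) :
    (∑ b, (bitWeight (signedBias δ A) b - bitWeight (fun _ => -δ) b) * F b) ^ 2
      ≤ 2 * (1 + δ ^ 2) ^ Aᶜ.card - 2 * (1 - δ ^ 2) ^ Aᶜ.card := by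
  -- `φ` is the reference law, of bias `-δ` on `A` and uniform elsewhere; `ψ c` is the density of
  -- bias `c` off `A` relative to it.
  set φ : ι → Bool → ℝ := fun i b => (if i ∈ A then 1 - δ * sgn b else 1) / 2 with hφ
  set ψ : ℝ → ι → Bool → ℝ := fun c i b => if i ∈ A then 1 else 1 + c * sgn b with hψ
  have hw : ∀ (b : ι → Bool), 0 ≤ ∏ i, φ i (b i) := fun b => Finset.prod_nonneg fun i _ => by
    have := bit_factor_nonneg (a := -δ) (by rwa [abs_neg, abs_of_nonneg hδ0]) (b i)
    simp only [hφ]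
    split_ifs
    · linarith
    · norm_num
  have hsplit₁ : ∀ b, bitWeight (signedBias δ A) b = (∏ i, φ i (b i)) * ∏ i, ψ δ i (b i) := by
    intro b
    rw [bitWeight, ← Finset.prod_mul_distrib]
    refine Finset.prod_congr rfl fun i _ => ?_
    by_cases h : i ∈ A <;> simp [h, signedBias, hφ, hψ] <;> ring
  have hsplit₂ : ∀ b : ι → Bool, bitWeight (fun _ => -δ) b
      = (∏ i, φ i (b i)) * ∏ i, ψ (-δ) i (b i) := by
    intro b
    rw [bitWeight, ← Finset.prod_mul_distrib]
    refine Finset.prod_congr rfl fun i _ => ?_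
    by_cases h : i ∈ A <;> simp [h, hφ, hψ] <;> ring
  have hmoment : ∀ c d : ℝ, ∑ b : ι → Bool, (∏ i, φ i (b i)) *
      ((∏ i, ψ c i (b i)) * ∏ i, ψ d i (b i)) = (1 + c * d) ^ Aᶜ.card := by
    intro c d
    simp_rw [← Finset.prod_mul_distrib]
    rw [sum_prod_bool fun i b => φ i b * (ψ c i b * ψ d i b)]
    rw [← Finset.prod_const, ← Finset.prod_subset (Finset.subset_univ Aᶜ)]
    · refine Finset.prod_congr rfl fun i hi => ?_
      rw [Finset.mem_compl] at hi
      simp only [hφ, hψ, hi, if_false, sgn_true, sgn_false]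
      ring
    · intro i _ hi
      rw [Finset.mem_compl, not_not] at hi
      simp only [hφ, hψ, hi, if_true, sgn_true, sgn_false]
      ring
  have hmass : ∑ b : ι → Bool, ∏ i, φ i (b i) = 1 := by
    rw [sum_prod_bool]
    refine Finset.prod_eq_one fun i _ => ?_
    by_cases h : i ∈ A
    · simp only [hφ, h, if_true, sgn_true, sgn_false]
      ring
    · simp only [hφ, h, if_false]
      norm_num
  have hCS := Finset.sum_sq_le_sum_mul_sum_of_sq_le_mul (Finset.univ : Finset (ι → Bool))
    (r := fun b => (bitWeight (signedBias δ A) b - bitWeight (fun _ => -δ) b) * F b)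
    (f := fun b => (∏ i, φ i (b i)) * F b ^ 2)
    (g := fun b => (∏ i, φ i (b i)) * (∏ i, ψ δ i (b i) - ∏ i, ψ (-δ) i (b i)) ^ 2)
    (fun b _ => mul_nonneg (hw b) (sq_nonneg _)) (fun b _ => mul_nonneg (hw b) (sq_nonneg _))
    (fun b _ => le_of_eq (by rw [hsplit₁, hsplit₂]; ring))
  have hleft : ∑ b, (∏ i, φ i (b i)) * F b ^ 2 ≤ 1 := by
    rw [← hmass]
    exact Finset.sum_le_sum fun b _ =>
      mul_le_of_le_one_right (hw b) (pow_le_one₀ (hF0 b) (hF1 b))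
  have hright : ∑ b : ι → Bool,
      (∏ i, φ i (b i)) * (∏ i, ψ δ i (b i) - ∏ i, ψ (-δ) i (b i)) ^ 2
      = 2 * (1 + δ ^ 2) ^ Aᶜ.card - 2 * (1 - δ ^ 2) ^ Aᶜ.card := by
    have h1 := hmoment δ δ
    have h2 := hmoment δ (-δ)
    have h3 := hmoment (-δ) (-δ)
    rw [show 1 + δ * δ = 1 + δ ^ 2 by ring] at h1
    rw [show 1 + δ * -δ = 1 - δ ^ 2 by ring] at h2
    rw [show 1 + -δ * -δ = 1 + δ ^ 2 by ring] at h3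
    calc _ = ∑ b : ι → Bool, ((∏ i, φ i (b i)) * ((∏ i, ψ δ i (b i)) * ∏ i, ψ δ i (b i))
          - 2 * ((∏ i, φ i (b i)) * ((∏ i, ψ δ i (b i)) * ∏ i, ψ (-δ) i (b i)))
          + (∏ i, φ i (b i)) * ((∏ i, ψ (-δ) i (b i)) * ∏ i, ψ (-δ) i (b i))) :=
          Finset.sum_congr rfl fun b _ => by ring
      _ = _ := by
        rw [Finset.sum_add_distrib, Finset.sum_sub_distrib, ← Finset.mul_sum, h1, h2, h3]
        ring
  calc _ ≤ _ := hCS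
    _ ≤ 1 * _ := mul_le_mul_of_nonneg_right hleft
        (Finset.sum_nonneg fun b _ => mul_nonneg (hw b) (sq_nonneg _))
    _ = _ := by rw [one_mul, hright]

/-- `(1 + x) ^ m ≤ exp (m x) ≤ 1 + 2 m x`, while Bernoulli gives `(1 - x) ^ m ≥ 1 - m x`. -/
theorem two_mul_pow_sub_pow_le {x : ℝ} (hx0 : 0 ≤ x) (hx1 : x ≤ 1) (m : ℕ) (hm : m * x ≤ 1) :
    2 * (1 + x) ^ m - 2 * (1 - x) ^ m ≤ 6 * (m * x) := by
  have h1 : (1 + x) ^ m ≤ 1 + 2 * (m * x) := by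
    calc (1 + x) ^ m ≤ Real.exp x ^ m :=
          pow_le_pow_left₀ (by linarith) (by linarith [Real.add_one_le_exp x]) m
      _ = Real.exp (m * x) := (Real.exp_nat_mul x m).symm
      _ ≤ _ := by
        have h := Real.abs_exp_sub_one_le (x := m * x) (by rwa [abs_of_nonneg (by positivity)])
        rw [abs_of_nonneg (show 0 ≤ m * x by positivity)] at h
        linarith [(abs_le.1 h).2]
  have h2 := one_add_mul_le_pow (a := -x) (by linarith) m
  rw [← sub_eq_add_neg] at h2
  linarith

/-- Two products of opposite biases `δ` and `-δ` cannot be told apart by a `[0, 1]`-valued test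
that is insensitive to the bits in `A`, when the bits outside of `A` are few. -/
theorem sum_bitWeight_sub_le_half {δ : ℝ} (hδ0 : 0 ≤ δ) (hδ1 : δ ≤ 1)
    (F : (ι → Bool) → ℝ) (hF0 : ∀ b, 0 ≤ F b) (hF1 : ∀ b, F b ≤ 1) (A : Finset ι) {K : ι → ℝ}
    (hF : ∀ i ∈ A, ∀ b b' : ι → Bool, (∀ j, j ≠ i → b j = b' j) → F b - F b' ≤ K i)
    (hK : δ * ∑ i ∈ A, K i ≤ 1 / 4) (hm : Aᶜ.card * δ ^ 2 ≤ 1 / 100) :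
    ∑ b, (bitWeight (fun _ => δ) b - bitWeight (fun _ => -δ) b) * F b ≤ 1 / 2 := by
  have h1 := sum_bitWeight_private_le hδ0 hδ1 F A hF
  have h2 := sq_sum_bitWeight_nonprivate_le hδ0 hδ1 F hF0 hF1 A
  have h3 := two_mul_pow_sub_pow_le (sq_nonneg δ) (pow_le_one₀ hδ0 hδ1) Aᶜ.card (by linarith)
  -- The squared gap is at most `6 / 100`, below `(1 / 4) ^ 2`.
  have h4 : ∑ b, (bitWeight (signedBias δ A) b - bitWeight (fun _ => -δ) b) * F b ≤ 1 / 4 :=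
    (abs_le_of_sq_le_sq' (by linarith) (by norm_num)).2
  calc _ = ∑ b, (bitWeight (fun _ => δ) b - bitWeight (signedBias δ A) b) * F b +
        ∑ b, (bitWeight (signedBias δ A) b - bitWeight (fun _ => -δ) b) * F b := by
        rw [← Finset.sum_add_distrib]
        exact Finset.sum_congr rfl fun b _ => by ring
    _ ≤ _ := by linarith

end Hypercube

end HeteroDP

namespace HeteroDP

/-! ### Le Cam's two-point lower bound and the conclusion. -/

section TwoPoint

/-- The two endpoints of the data domain. -/
noncomputable def endpoint (b : Bool) : DataPoint :=
  ⟨sgn b / 2, by cases b <;> constructor <;> norm_num⟩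

/-- The probability measure on the endpoints of the data domain with mean `δ / 2`. -/
noncomputable def twoPoint (δ : ℝ) : Measure DataPoint :=
  ∑ b : Bool, ENNReal.ofReal ((1 + δ * sgn b) / 2) • Measure.dirac (endpoint b)

theorem isProbabilityMeasure_twoPoint {δ : ℝ} (hδ : |δ| ≤ 1) :
    IsProbabilityMeasure (twoPoint δ) := by
  refine ⟨?_⟩
  rw [twoPoint, Measure.finsetSum_apply]
  simp only [Measure.smul_apply, measure_univ, smul_eq_mul, mul_one]
  rw [← ENNReal.ofReal_sum_of_nonneg fun b _ => bit_factor_nonneg hδ b]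
  simp only [Fintype.sum_bool, sgn_true, sgn_false]
  rw [← ENNReal.ofReal_one]
  congr 1
  ring

theorem mean_twoPoint {δ : ℝ} (hδ : |δ| ≤ 1) : mean (twoPoint δ) = δ / 2 := by
  rw [mean, twoPoint, integral_finsetSum_measure]
  · simp only [integral_smul_measure, integral_dirac, smul_eq_mul,
      ENNReal.toReal_ofReal (bit_factor_nonneg hδ _), endpoint, Fintype.sum_bool, sgn_true,
      sgn_false]
    ring
  · intro b _
    exact (integrable_dirac (by simp)).smul_measure ENNReal.ofReal_ne_top

theorem pi_twoPoint {n : ℕ} {δ : ℝ} (hδ : |δ| ≤ 1) :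
    (Measure.pi fun _ : Fin n => twoPoint δ) = ∑ b : Fin n → Bool,
      ENNReal.ofReal (bitWeight (fun _ => δ) b) • Measure.dirac fun i => endpoint (b i) := by
  have := isProbabilityMeasure_twoPoint hδ
  refine Measure.pi_eq fun s hs => ?_
  simp only [twoPoint, Measure.finsetSum_apply, Measure.smul_apply, smul_eq_mul]
  have h := sum_prod_bool fun (i : Fin n) b =>
    ENNReal.ofReal ((1 + δ * sgn b) / 2) * Measure.dirac (endpoint b) (s i)
  simp only [Fintype.sum_bool]
  rw [← h]
  refine Finset.sum_congr rfl fun b _ => ?_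
  rw [Finset.prod_mul_distrib, bitWeight,
    ENNReal.ofReal_prod_of_nonneg fun i _ => bit_factor_nonneg hδ (b i),
    Measure.dirac_apply' _ (MeasurableSet.univ_pi hs)]
  congr 1
  simp only [Measure.dirac_apply' _ (hs _)]
  by_cases hb : ∀ i, endpoint (b i) ∈ s i
  · rw [Set.indicator_of_mem (Set.mem_univ_pi.2 hb)]
    exact (Finset.prod_eq_one fun i _ => by rw [Set.indicator_of_mem (hb i)]; rfl).symm
  · rw [Set.indicator_of_notMem fun h => hb (Set.mem_univ_pi.1 h)]
    obtain ⟨i, hi⟩ := not_forall.1 hb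
    exact (Finset.prod_eq_zero (Finset.mem_univ i) (Set.indicator_of_notMem hi _)).symm

variable {n : ℕ} {ε : Fin n → ℝ}

/-- Markov's inequality: only outputs in `S`, at distance at least `|δ| / 2` from the mean, are
counted. -/
theorem le_mse_twoPoint (M : Kernel (Fin n → DataPoint) ℝ) [IsMarkovKernel M] {δ : ℝ}
    (hδ : |δ| ≤ 1) {S : Set ℝ} (hS : MeasurableSet S)
    (hfar : ∀ y ∈ S, δ ^ 2 / 4 ≤ (y - δ / 2) ^ 2) :
    ENNReal.ofReal (δ ^ 2 / 4 *
        ∑ b : Fin n → Bool, bitWeight (fun _ => δ) b * (M fun i => endpoint (b i)).real S)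
      ≤ mse M (twoPoint δ) := by
  have hmeas : Measurable fun x => ∫⁻ y, ENNReal.ofReal ((y - δ / 2) ^ 2) ∂(M x) :=
    Measurable.lintegral_kernel (by fun_prop)
  rw [mse, mean_twoPoint hδ, pi_twoPoint hδ, lintegral_finsetSum_measure, Finset.mul_sum,
    ENNReal.ofReal_sum_of_nonneg fun b _ => mul_nonneg (by positivity)
      (mul_nonneg (bitWeight_nonneg (fun _ => hδ) b) measureReal_nonneg)]
  refine Finset.sum_le_sum fun b _ => ?_
  rw [lintegral_smul_measure, lintegral_dirac' _ hmeas, smul_eq_mul, mul_left_comm,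
    ENNReal.ofReal_mul (bitWeight_nonneg (fun _ => hδ) b), ENNReal.ofReal_mul (by positivity),
    ofReal_measureReal]
  gcongr
  calc _ = ∫⁻ _ in S, ENNReal.ofReal (δ ^ 2 / 4) ∂(M fun i => endpoint (b i)) := by simp
    _ ≤ ∫⁻ y in S, ENNReal.ofReal ((y - δ / 2) ^ 2) ∂(M fun i => endpoint (b i)) :=
      setLIntegral_mono' hS fun y hy => ENNReal.ofReal_le_ofReal (hfar y hy)
    _ ≤ _ := setLIntegral_le_lintegral _ _

theorem IsDP.real_sub_le {M : Kernel (Fin n → DataPoint) ℝ} [IsMarkovKernel M] (hM : IsDP M ε)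
    {i : Fin n} (hε0 : 0 ≤ ε i) (hε1 : ε i ≤ 1) {x x' : Fin n → DataPoint}
    (hx : ∀ j, j ≠ i → x j = x' j) {S : Set ℝ} (hS : MeasurableSet S) :
    (M x).real S - (M x').real S ≤ 2 * ε i := by
  have h : (M x).real S ≤ Real.exp (ε i) * (M x').real S := by
    have h := ENNReal.toReal_mono (by finiteness) (hM i x x' hx S hS)
    rwa [ENNReal.toReal_mul, ENNReal.toReal_ofReal (Real.exp_pos _).le] at h
  have hexp : Real.exp (ε i) - 1 ≤ 2 * ε i := by
    have h := Real.abs_exp_sub_one_le (x := ε i) (by rwa [abs_of_nonneg hε0])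
    rw [abs_of_nonneg hε0] at h
    exact (abs_le.1 h).2
  have h1 : (M x').real S ≤ 1 := measureReal_le_one
  have h0 : 0 ≤ (M x').real S := measureReal_nonneg
  nlinarith

/-- The sign of the output tests the sign of the bias, and a wrong sign costs at least `δ² / 4`.
Under one of the two laws the sign is wrong with probability at least `1/4`. -/
theorem le_worstCaseError {M : Kernel (Fin n → DataPoint) ℝ} [IsMarkovKernel M] (hM : IsDP M ε)
    (hε : ∀ i, 0 < ε i) (A : Finset (Fin n)) (hA : ∀ i ∈ A, ε i ≤ 1) {δ : ℝ} (hδ0 : 0 ≤ δ)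
    (hδ1 : δ ≤ 1) (hK : δ * ∑ i ∈ A, ε i ≤ 1 / 8) (hm : Aᶜ.card * δ ^ 2 ≤ 1 / 100) :
    ENNReal.ofReal (δ ^ 2 / 16) ≤ worstCaseError M := by
  have hδ : |δ| ≤ 1 := by rwa [abs_of_nonneg hδ0]
  have hδ' : |-δ| ≤ 1 := by rwa [abs_neg]
  have hS : MeasurableSet (Set.Ici (0 : ℝ)) := measurableSet_Ici
  set F : (Fin n → Bool) → ℝ := fun b => (M fun i => endpoint (b i)).real (Set.Ici 0) with hF
  have hlecam := sum_bitWeight_sub_le_half hδ0 hδ1 F (fun _ => measureReal_nonneg)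
    (fun _ => measureReal_le_one) A (K := fun i => 2 * ε i)
    (fun i hi b b' hb => hM.real_sub_le (hε i).le (hA i hi)
      (fun j hj => by rw [hb j hj]) hS)
    (by rw [← Finset.mul_sum]; linarith) hm
  have hpos := le_mse_twoPoint M hδ hS.compl fun y hy => by
    have hy : y < 0 := by simpa using hy
    nlinarith
  have hneg := le_mse_twoPoint M hδ' hS fun y hy => by
    have hy : 0 ≤ y := hy
    nlinarith
  have hsup : ∀ a : ℝ, |a| ≤ 1 → mse M (twoPoint a) ≤ worstCaseError M := fun a ha =>
    le_iSup₂_of_le (twoPoint a) (isProbabilityMeasure_twoPoint ha) le_rfl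
  have hcompl : ∑ b : Fin n → Bool, bitWeight (fun _ => δ) b *
      (M fun i => endpoint (b i)).real (Set.Ici 0)ᶜ = 1 - ∑ b, bitWeight (fun _ => δ) b * F b := by
    have h1 := sum_bitWeight fun _ : Fin n => δ
    simp_rw [probReal_compl_eq_one_sub hS, mul_sub, mul_one, Finset.sum_sub_distrib]
    rw [h1]
  rw [hcompl] at hpos
  simp_rw [sub_mul, Finset.sum_sub_distrib] at hlecam
  rcases le_total (1 / 4) (∑ b, bitWeight (fun _ => -δ) b * F b) with h | h
  · refine le_trans (ENNReal.ofReal_le_ofReal ?_) (hneg.trans (hsup _ hδ'))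
    rw [neg_sq]
    nlinarith [mul_le_mul_of_nonneg_left h (sq_nonneg δ)]
  · refine le_trans (ENNReal.ofReal_le_ofReal ?_) (hpos.trans (hsup _ hδ))
    have h' : 1 / 4 ≤ 1 - ∑ b, bitWeight (fun _ => δ) b * F b := by linarith
    nlinarith [mul_le_mul_of_nonneg_left h' (sq_nonneg δ)]

theorem le_minimaxRisk (hε : ∀ i, 0 < ε i) {θ : ℝ} (hθ : 0 < θ)
    (h : θ * ∑ i, min (ε i) θ = 1) :
    ENNReal.ofReal (min (θ / 10) 1 ^ 2 / 16) ≤ minimaxRisk ε := by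
  refine le_iInf₂ fun M ⟨hM, hDP, _⟩ => ?_
  classical
  set A : Finset (Fin n) := {i | ε i ≤ θ} with hAdef
  have hmin : ∀ i, 0 < min (ε i) θ := fun i => lt_min (hε i) hθ
  -- The balance equation splits into a privacy and a sampling budget, both at most `1`; shrinking
  -- `θ` to `δ ≤ θ / 10` leaves at most `1/10` and `1/100`.
  have hsplit : θ * ∑ i ∈ A, ε i + Aᶜ.card * θ ^ 2 = 1 := by
    rw [← h, ← Finset.sum_add_sum_compl A, mul_add]
    congr 1
    · congr 1
      exact Finset.sum_congr rfl fun i hi =>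
        (min_eq_left (Finset.mem_filter.1 hi).2).symm
    · rw [Finset.sum_congr rfl fun i hi => min_eq_right (a := ε i) (b := θ) ?_]
      · simp; ring
      · have : ¬ ε i ≤ θ := by simpa [hAdef] using hi
        linarith
  have hsum : 0 ≤ θ * ∑ i ∈ A, ε i :=
    mul_nonneg hθ.le (Finset.sum_nonneg fun i _ => (hε i).le)
  have hcard : 0 ≤ Aᶜ.card * θ ^ 2 := by positivity
  have hδ0 : 0 ≤ min (θ / 10) 1 := le_min (by positivity) zero_le_one
  have hδθ : min (θ / 10) 1 ≤ θ / 10 := min_le_left _ _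
  refine le_worstCaseError hDP hε A (fun i hi => ?_) hδ0 (min_le_right _ _) ?_ ?_
  · have hi' : ε i ≤ θ := (Finset.mem_filter.1 hi).2
    have hle : ε i ≤ ∑ i ∈ A, ε i := Finset.single_le_sum (fun i _ => (hε i).le) hi
    have : θ * ε i ≤ 1 := (mul_le_mul_of_nonneg_left hle hθ.le).trans (by linarith)
    -- `ε i ^ 2 ≤ θ * ε i ≤ 1`.
    nlinarith [hε i]
  · calc _ ≤ θ / 10 * ∑ i ∈ A, ε i :=
          mul_le_mul_of_nonneg_right hδθ (Finset.sum_nonneg fun i _ => (hε i).le)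
      _ ≤ _ := by linarith
  · calc (Aᶜ.card : ℝ) * min (θ / 10) 1 ^ 2 ≤ Aᶜ.card * (θ / 10) ^ 2 := by gcongr
      _ = Aᶜ.card * θ ^ 2 / 100 := by ring
      _ ≤ _ := by linarith

theorem worstCaseError_adpm_le_minimaxRisk (hn : 1 ≤ n) (hε : ∀ i, 0 < ε i) :
    worstCaseError (adpm ε) ≤ ((7200 : ℝ≥0) : ℝ≥0∞) * minimaxRisk ε := by
  obtain ⟨θ, hθ, h⟩ := exists_balanced_level hn hε
  have hrate := adpm_rate_le hn hε hθ h
  calc _ ≤ _ := worstCaseError_adpm_le hn hε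
    -- The constant matches `9 θ² / 2 = 7200 * (θ / 10)² / 16`; for `θ ≥ 10` the bound `1/2` has
    -- ample room.
    _ ≤ ENNReal.ofReal (7200 * (min (θ / 10) 1 ^ 2 / 16)) := by
      refine ENNReal.ofReal_le_ofReal ?_
      rcases le_total (θ / 10) 1 with h1 | h1
      · rw [min_eq_left h1]
        refine (min_le_right _ _).trans ?_
        have : (adpmL₂ ε + 8) / (2 * adpmL₁ ε ^ 2) = (adpmL₂ ε + 8) / adpmL₁ ε ^ 2 / 2 := by
          rw [div_div, mul_comm 2]
        rw [this]
        linarith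
      · rw [min_eq_right h1]
        refine (min_le_left _ _).trans ?_
        norm_num
    _ = ((7200 : ℝ≥0) : ℝ≥0∞) * ENNReal.ofReal (min (θ / 10) 1 ^ 2 / 16) := by
      rw [ENNReal.ofReal_mul (by norm_num)]
      congr 1
      simp
    _ ≤ _ := by
      gcongr
      exact le_minimaxRisk hε hθ h

end TwoPoint

end HeteroDP

theorem theorem1 :
    ∃ C : ℝ≥0, ∀ (n : ℕ), 1 ≤ n → ∀ ε : Fin n → ℝ, (∀ i, 0 < ε i) →
      IsMarkovKernel (HeteroDP.adpm ε) ∧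
      HeteroDP.IsDP (HeteroDP.adpm ε) ε ∧
      HeteroDP.minimaxRisk ε ≤ HeteroDP.worstCaseError (HeteroDP.adpm ε) ∧
      HeteroDP.worstCaseError (HeteroDP.adpm ε) ≤ (C : ℝ≥0∞) * HeteroDP.minimaxRisk ε := by
  refine ⟨7200, fun n hn ε hε => ?_⟩
  have hMarkov := HeteroDP.isMarkovKernel_adpm hn hε
  have hDP := HeteroDP.isDP_adpm hn hε
  exact ⟨hMarkov, hDP, HeteroDP.minimaxRisk_le hDP,
    HeteroDP.worstCaseError_adpm_le_minimaxRisk hn hε⟩
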